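/- Let $\ell^2=\ell^2(\mathbb N_0)$ be the complex Hilbert space of square summable sequences (with inner product linear in the second argument), let $\delta_0=(1,0,0,\dots)$, and for a sequence $u=(u_n)_{n\ge 0}$ put $$(\tau u)_0=u_0+u_1,\qquad (\tau u)_n=n\,u_{n-1}+(2n+1)\,u_n+(n+1)\,u_{n+1}\quad(n\ge 1).$$ Let $H_0$ be the maximal Laguerre Jacobi operator, $H_0u=\tau u$ with domain $\mathcal D_{\max}=\{u\in\ell^2:\tau u\in\ell^2\}$. Let $d\rho(\lambda)=\mathbb 1_{[0,\infty)}(\lambda)e^{-\lambda}d\lambda$ on $\mathbb R$, and let $E_1(z)=\int_z^{\infty}\frac{e^{-w}}{w}\,dw$, $z\in\mathbb C\setminus(-\infty,0]$, be the principal value of the exponential integral (with the path of integration avoiding $(-\infty,0]$, for instance $w=z+t$, $t\ge0$). **Theorem 2.1.** (i) $H_0$ is self-adjoint and positive: $\langle u,H_0u\rangle>0$ for all $0\neq u\in\mathcal D_{\max}$. (ii) The Weyl function $m_0(z)=\langle\delta_0,(H_0-z)^{-1}\delta_0\rangle$ is given by $$m_0(z)=e^{-z}E_1(-z)=\int_0^{+\infty}\frac{e^{-\lambda}}{\lambda-z}\,d\lambda,\qquad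 z\in\mathbb C\setminus[0,\infty),$$ and the integral converges absolutely. The spectral measure of $H_0$ is $\rho$: the operator $H_0$ has a spectral resolution $H_0=\int\lambda\,dE(\lambda)$ with a projection-valued measure $E$ on $\mathbb R$ such that $\langle\delta_0,E(B)\delta_0\rangle=\rho(B)$ for all Borel sets $B\subseteq\mathbb R$; moreover, some unitary map $U:\ell^2\to L^2(\mathbb R,d\rho)$ with $U\delta_0=1$ transforms $H_0$ into the maximal operator of multiplication by $\lambda$ in $L^2(\mathbb R,d\rho)$. (iii) The spectrum of $H_0$ is purely absolutely continuous, that is, for every $u\in\ell^2$ the measure $B\mapsto\langle u,E(B)u\rangle$ is absolutely continuous with respect to Lebesgue measure, and it is equal to $[0,\infty)$. -/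

import Mathlib

open MeasureTheory

noncomputable section

namespace LaguerreJacobi

/-! ### Unbounded operators: positivity, resolvent, spectrum -/

section Operators

variable {H : Type*} [NormedAddCommGroup H] [InnerProductSpace ℂ H]

/-- Positivity of an operator: `⟨u, A u⟩` is real and strictly positive for every nonzero `u` in
the domain of `A`. -/
def IsPositiveOperator (A : H →ₗ.[ℂ] H) : Prop :=
  ∀ u : A.domain, u ≠ 0 → (inner ℂ (u : H) (A u)).im = 0 ∧ 0 < (inner ℂ (u : H) (A u)).re

/-- The bounded operator `R` is the two-sided inverse of `A - z : dom A → H`. -/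
def IsResolventAt (A : H →ₗ.[ℂ] H) (z : ℂ) (R : H →L[ℂ] H) : Prop :=
  (∀ v : H, ∃ h : R v ∈ A.domain, A ⟨R v, h⟩ - z • R v = v) ∧
    ∀ u : A.domain, R (A u - z • (u : H)) = u

/-- The set of all `z` such that `A - z : dom A → H` has a bounded everywhere defined inverse. -/
def resolventSet (A : H →ₗ.[ℂ] H) : Set ℂ :=
  {z | ∃ R : H →L[ℂ] H, IsResolventAt A z R}

/-- The spectrum of an (unbounded) operator. -/
def spectrum (A : H →ₗ.[ℂ] H) : Set ℂ :=
  (resolventSet A)ᶜ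

open Classical in
/-- The resolvent `(A - z)⁻¹`; it is given the value `0` if `z` lies in the spectrum. -/
def resolvent (A : H →ₗ.[ℂ] H) (z : ℂ) : H →L[ℂ] H :=
  if h : ∃ R : H →L[ℂ] H, IsResolventAt A z R then h.choose else 0

end Operators

/-! ### Projection-valued measures -/

/-- A projection-valued measure on the Borel sets of `ℝ`: every value is an orthogonal projection,
the whole line is mapped to the identity, and the measure is countably additive in the strong
operator topology. On non-measurable sets it takes the value `0` by convention. -/
structure ProjectionValuedMeasure (H : Type*) [NormedAddCommGroup H] [InnerProductSpace ℂ H]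
    [CompleteSpace H] where
  proj : Set ℝ → (H →L[ℂ] H)
  isStarProjection : ∀ B, MeasurableSet B → IsStarProjection (proj B)
  proj_univ : proj Set.univ = 1
  hasSum_proj : ∀ B : ℕ → Set ℝ, (∀ n, MeasurableSet (B n)) → Pairwise (Function.onFun Disjoint B) →
    ∀ u : H, HasSum (fun n => proj (B n) u) (proj (⋃ n, B n) u)
  proj_of_not_measurable : ∀ B, ¬ MeasurableSet B → proj B = 0

namespace ProjectionValuedMeasure

variable {H : Type*} [NormedAddCommGroup H] [InnerProductSpace ℂ H] [CompleteSpace H]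

theorem inner_proj_nonneg (E : ProjectionValuedMeasure H) {B : Set ℝ} (hB : MeasurableSet B)
    (u : H) : 0 ≤ (inner ℂ u (E.proj B u)).re := by
  have h := E.isStarProjection B hB
  have h1 : E.proj B (E.proj B u) = E.proj B u := by
    have := congrArg (fun T : H →L[ℂ] H => T u) h.isIdempotentElem.eq
    simpa using this
  have h2 : inner ℂ u (E.proj B u) = inner ℂ (E.proj B u) (E.proj B u) := by
    conv_lhs => rw [← h1]
    rw [← ContinuousLinearMap.adjoint_inner_left, ← ContinuousLinearMap.star_eq_adjoint,
      h.isSelfAdjoint.star_eq]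
  rw [h2]
  exact inner_self_nonneg (𝕜 := ℂ)

theorem proj_empty (E : ProjectionValuedMeasure H) : E.proj ∅ = 0 := by
  ext u
  have h := E.hasSum_proj (fun _ => ∅) (fun _ => MeasurableSet.empty)
    (fun _ _ _ => by simp [Function.onFun]) u
  simpa using (tendsto_nhds_unique h.summable.tendsto_atTop_zero tendsto_const_nhds).symm

/-- The scalar spectral measure `B ↦ ⟨u, E(B) u⟩` of the vector `u`. -/
def scalarMeasure (E : ProjectionValuedMeasure H) (u : H) : Measure ℝ :=
  Measure.ofMeasurable (fun B _ => ENNReal.ofReal (inner ℂ u (E.proj B u)).re)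
    (by simp [E.proj_empty])
    (by
      intro B hB hd
      have h := E.hasSum_proj B hB hd u
      have h2 : HasSum (fun n => (inner ℂ u (E.proj (B n) u)).re)
          (inner ℂ u (E.proj (⋃ n, B n) u)).re :=
        Complex.reCLM.hasSum ((innerSL ℂ u).hasSum h)
      rw [← h2.tsum_eq]
      exact ENNReal.ofReal_tsum_of_nonneg (fun n => E.inner_proj_nonneg (hB n) u) h2.summable)

/-- `E` is a spectral resolution of the operator `A`, that is, `A = ∫ x dE(x)`: the domain of `A`
consists of all `u` with `∫ x² d⟨u, E u⟩ < ∞`, and `⟨u, A u⟩ = ∫ x d⟨u, E u⟩` for all such `u`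
(which determines `A` by polarization). -/
def IsResolutionOf (E : ProjectionValuedMeasure H) (A : H →ₗ.[ℂ] H) : Prop :=
  (∀ u : H, u ∈ A.domain ↔ Integrable (fun x : ℝ => x ^ 2) (E.scalarMeasure u)) ∧
    ∀ u : A.domain, inner ℂ (u : H) (A u) = ((∫ x : ℝ, x ∂(E.scalarMeasure (u : H)) : ℝ) : ℂ)

end ProjectionValuedMeasure

/-- The unitary map `U` turns `A` into the maximal operator of multiplication by the independent
variable in `L²(ρ)`, and it maps the vector `φ` to the constant function `1`. -/
def IsSpectralTransform {H : Type*} [NormedAddCommGroup H] [InnerProductSpace ℂ H]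
    (A : H →ₗ.[ℂ] H) (φ : H) (ρ : Measure ℝ) (U : H ≃ₗᵢ[ℂ] Lp ℂ 2 ρ) : Prop :=
  (∀ᵐ x ∂ρ, U φ x = 1) ∧
    (∀ u : H, u ∈ A.domain ↔ MemLp (fun x : ℝ => (x : ℂ) * U u x) 2 ρ) ∧
    ∀ u : A.domain, ∀ᵐ x ∂ρ, U (A u) x = (x : ℂ) * U (u : H) x

/-! ### The Laguerre Jacobi operator -/

/-- The Hilbert space of square summable complex sequences `(u₀, u₁, …)`. -/
abbrev ℓ2 : Type := lp (fun _ : ℕ => ℂ) 2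

/-- The difference expression given by the Jacobi matrix with diagonal entries `2n + 1` and
off-diagonal entries `n + 1`. -/
def tau (u : ℕ → ℂ) : ℕ → ℂ
  | 0 => u 0 + u 1
  | n + 1 => ((n : ℂ) + 1) * u n + (2 * ((n : ℂ) + 1) + 1) * u (n + 1)
      + (((n : ℂ) + 1) + 1) * u (n + 2)

theorem tau_add (u v : ℕ → ℂ) : tau (u + v) = tau u + tau v := by
  funext n
  cases n <;> simp only [tau, Pi.add_apply] <;> ring

theorem tau_smul (c : ℂ) (u : ℕ → ℂ) : tau (c • u) = c • tau u := by
  funext n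
  cases n <;> simp only [tau, Pi.smul_apply, smul_eq_mul] <;> ring

/-- The maximal domain: all `u ∈ ℓ²` with `τ u ∈ ℓ²`. -/
def maximalDomain : Submodule ℂ ℓ2 where
  carrier := {u | Memℓp (tau u) 2}
  zero_mem' := by
    have h : tau ((0 : ℓ2) : ℕ → ℂ) = 0 := by
      funext n
      cases n <;> simp [tau]
    simp only [Set.mem_ofPred_eq, h]
    exact zero_memℓp
  add_mem' {u v} hu hv := by
    simp only [Set.mem_ofPred_eq, lp.coeFn_add, tau_add] at *
    exact hu.add hv
  smul_mem' c u hu := by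
    simp only [Set.mem_ofPred_eq, lp.coeFn_smul, tau_smul] at *
    exact hu.const_smul c

/-- The maximal Laguerre Jacobi operator `H₀ u = τ u` on the maximal domain. -/
def H0 : ℓ2 →ₗ.[ℂ] ℓ2 where
  domain := maximalDomain
  toFun :=
    { toFun := fun u => ⟨tau (u : ℓ2), u.2⟩
      map_add' := fun u v => by
        ext n
        exact congrFun (tau_add (u : ℓ2) (v : ℓ2)) n
      map_smul' := fun c u => by
        ext n
        exact congrFun (tau_smul c (u : ℓ2)) n }

/-- The first unit vector `(1, 0, 0, …)`. -/
def delta0 : ℓ2 := lp.single 2 0 (1 : ℂ)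

/-- The Weyl function `m₀(z) = ⟨δ₀, (H₀ - z)⁻¹ δ₀⟩` (the inner product is linear in the second
argument). -/
def weylFunction (z : ℂ) : ℂ :=
  inner ℂ delta0 (resolvent H0 z delta0)

/-- The measure `1_{[0,∞)}(x) e^{-x} dx` on the real line. -/
def expMeasure : Measure ℝ :=
  volume.withDensity fun x => ENNReal.ofReal ((Set.Ici (0 : ℝ)).indicator (fun y => Real.exp (-y)) x)

/-- The principal value of the exponential integral `E₁(z) = ∫_z^∞ e^{-w} / w dw` for
`z ∉ (-∞, 0]`, along the path `w = z + t`, `t ≥ 0`, which does not meet `(-∞, 0]`. -/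
def expIntegralE1 (z : ℂ) : ℂ :=
  ∫ t in Set.Ioi (0 : ℝ), Complex.exp (-(z + t)) / (z + t)

end LaguerreJacobi

end

/-!
The unitary map `U` sends the unit vector `δₙ` to `(-1)ⁿ Lₙ`, the sign-normalized Laguerre
polynomial. The three-term recurrence of these polynomials turns `τ` into multiplication by the
independent variable, and since both the domain of `H0` and that of the multiplication operator are
maximal, `U` intertwines the two operators. Self-adjointness, positivity, resolvent, spectrum and
spectral measure of `H0` can then be read off the multiplication operator.

Orthonormality reduces to `∫ xᵐ e⁻ˣ dx = m!` and the forward differences of binomial coefficients.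
For completeness, let `f ∈ L²(e⁻ˣ dx)` have vanishing moments. The measures with densities `|g|`
and `g + |g|`, for `g` the real or imaginary part of `f`, have finite exponential moments, so their
complex moment generating functions are analytic in a strip around the imaginary axis. All their
derivatives at `0` agree, so they agree on the imaginary axis, where they are the characteristic
functions; hence `g = 0`.
-/

noncomputable section

namespace LaguerreJacobi

/-! ### Unbounded operators -/

section UnboundedOperators

variable {H : Type*} [NormedAddCommGroup H] [InnerProductSpace ℂ H] {A : H →ₗ.[ℂ] H}
  {z : ℂ}

theorem im_inner_apply_self_eq_zero (hA : A.IsFormalAdjoint A) (u : A.domain) :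
    (inner ℂ (u : H) (A u)).im = 0 := by
  rw [← Complex.conj_eq_iff_im, inner_conj_symm]
  exact hA u u

theorem dense_domain_of_surjective_sub [CompleteSpace H] (hA : A.IsFormalAdjoint A) (hz : z.im ≠ 0)
    (h : ∀ v : H, ∃ u : A.domain, A u - z • (u : H) = v) : Dense (A.domain : Set H) := by
  rw [Submodule.dense_iff_topologicalClosure_eq_top, Submodule.topologicalClosure_eq_top_iff,
    Submodule.eq_bot_iff]
  intro v hv
  obtain ⟨u, rfl⟩ := h v
  have h0 : inner ℂ (u : H) (A u) - z * (‖(u : H)‖ : ℂ) ^ 2 = 0 := by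
    simpa [inner_sub_right, inner_smul_right, inner_self_eq_norm_sq_to_K] using
      hv u u.2
  have him : z.im * ‖(u : H)‖ ^ 2 = 0 := by
    have := congrArg Complex.im h0
    rw [Complex.sub_im, im_inner_apply_self_eq_zero hA, ← Complex.ofReal_pow,
      Complex.im_mul_ofReal, zero_sub, Complex.zero_im] at this
    exact neg_eq_zero.mp this
  have hu : u = 0 := by simpa [hz] using him
  simp [hu]

theorem isSelfAdjoint_of_surjective_sub [CompleteSpace H] (hA : A.IsFormalAdjoint A) (hz : z.im ≠ 0)
    (hsurj : ∀ v : H, ∃ u : A.domain, A u - z • (u : H) = v)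
    (hsurj_conj : ∀ v : H, ∃ u : A.domain, A u - (starRingEnd ℂ) z • (u : H) = v) :
    IsSelfAdjoint A := by
  have hd := dense_domain_of_surjective_sub hA hz hsurj
  have hle : A ≤ A.adjoint := hA.le_adjoint hd
  rw [LinearPMap.isSelfAdjoint_def]
  refine (LinearPMap.eq_of_le_of_domain_eq hle (le_antisymm hle.1 fun y hy => ?_)).symm
  obtain ⟨u, hu⟩ := hsurj (A.adjoint ⟨y, hy⟩ - z • y)
  obtain ⟨w, hw⟩ := hsurj_conj (y - u)
  -- `y - u` lies in the kernel of `A† - z`, so it is orthogonal to the range of `A - z̄`.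
  have horth : inner ℂ (y - u) (A w - (starRingEnd ℂ) z • (w : H)) = 0 := by
    have hy' := LinearPMap.adjoint_isFormalAdjoint hd ⟨y, hy⟩ w
    have hu' := hA u w
    have := congrArg (fun v => inner ℂ v (w : H)) hu
    simp only [inner_sub_left, inner_smul_left, inner_sub_right, inner_smul_right] at this ⊢
    rw [← hy', ← hu']
    linear_combination -this
  rw [hw, inner_self_eq_zero, sub_eq_zero] at horth
  exact horth ▸ u.2

end UnboundedOperators

namespace IsResolventAt

variable {H : Type*} [NormedAddCommGroup H] [InnerProductSpace ℂ H] {A : H →ₗ.[ℂ] H} {z : ℂ}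
  {R S : H →L[ℂ] H}

theorem unique (hR : IsResolventAt A z R) (hS : IsResolventAt A z S) : R = S := by
  ext1 v
  obtain ⟨h, hv⟩ := hS.1 v
  simpa only [hv] using hR.2 ⟨S v, h⟩

theorem resolvent_eq (hR : IsResolventAt A z R) : resolvent A z = R := by
  have h : ∃ R : H →L[ℂ] H, IsResolventAt A z R := ⟨R, hR⟩
  rw [resolvent, dif_pos h]
  exact h.choose_spec.unique hR

theorem surjective_sub (hR : IsResolventAt A z R) (v : H) :
    ∃ u : A.domain, A u - z • (u : H) = v :=
  let ⟨h, hv⟩ := hR.1 v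
  ⟨⟨R v, h⟩, hv⟩

theorem norm_le (hR : IsResolventAt A z R) (u : A.domain) :
    ‖(u : H)‖ ≤ ‖R‖ * ‖A u - z • (u : H)‖ := by
  simpa only [hR.2 u] using R.le_opNorm (A u - z • (u : H))

end IsResolventAt

theorem mem_spectrum_of_forall_exists_norm_sub_le {H : Type*} [NormedAddCommGroup H]
    [InnerProductSpace ℂ H] {A : H →ₗ.[ℂ] H} {z : ℂ}
    (h : ∀ ε > 0, ∃ u : A.domain, u ≠ 0 ∧ ‖A u - z • (u : H)‖ ≤ ε * ‖(u : H)‖) :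
    z ∈ spectrum A := by
  rintro ⟨R, hR⟩
  obtain ⟨u, hu0, hu⟩ := h (‖R‖ + 1)⁻¹ (by positivity)
  have hpos : 0 < ‖(u : H)‖ := by simpa using hu0
  have hlt : ‖R‖ * (‖R‖ + 1)⁻¹ < 1 := by
    rw [← div_eq_mul_inv, div_lt_one (by positivity)]
    exact lt_add_one _
  have := calc ‖(u : H)‖ ≤ ‖R‖ * ‖A u - z • (u : H)‖ := hR.norm_le u
    _ ≤ ‖R‖ * (‖R‖ + 1)⁻¹ * ‖(u : H)‖ := by rw [mul_assoc]; gcongr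
    _ < 1 * ‖(u : H)‖ := by gcongr
  simp at this

/-! ### Multiplication operators -/

section Multiplication

open scoped ENNReal

variable {α 𝕜 : Type*} [MeasurableSpace α] [RCLike 𝕜] {ρ : Measure α}

/-- The bounded operator of multiplication by an essentially bounded function on `L²(ρ)`. -/
def mulLp (φ : Lp 𝕜 ∞ ρ) : Lp 𝕜 2 ρ →L[𝕜] Lp 𝕜 2 ρ :=
  (ContinuousLinearMap.mul 𝕜 𝕜).holderL ρ ∞ 2 2 φ

theorem coeFn_mulLp (φ : Lp 𝕜 ∞ ρ) (f : Lp 𝕜 2 ρ) : mulLp φ f =ᵐ[ρ] fun x => φ x * f x :=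
  (ContinuousLinearMap.mul 𝕜 𝕜).coeFn_holder φ f

variable (𝕜 ρ) in
/-- The orthogonal projection `f ↦ 1_B f` of `L²(ρ)`. -/
def indicatorLp {B : Set α} (hB : MeasurableSet B) : Lp 𝕜 2 ρ →L[𝕜] Lp 𝕜 2 ρ :=
  mulLp (((memLp_top_const (1 : 𝕜)).indicator hB).toLp _)

variable {B C : Set α}

theorem coeFn_indicatorLp (hB : MeasurableSet B) (f : Lp 𝕜 2 ρ) :
    indicatorLp 𝕜 ρ hB f =ᵐ[ρ] B.indicator f := by
  filter_upwards [coeFn_mulLp _ f, ((memLp_top_const (1 : 𝕜)).indicator hB).coeFn_toLp]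
    with x hx h1
  rw [indicatorLp, hx, h1, ← Set.indicator_mul_left]
  simp only [one_mul]

theorem indicatorLp_apply_apply (hB : MeasurableSet B) (hC : MeasurableSet C) (f : Lp 𝕜 2 ρ) :
    indicatorLp 𝕜 ρ hB (indicatorLp 𝕜 ρ hC f) = indicatorLp 𝕜 ρ (hB.inter hC) f := by
  refine Lp.ext ?_
  filter_upwards [coeFn_indicatorLp hB (indicatorLp 𝕜 ρ hC f), coeFn_indicatorLp hC f,
    coeFn_indicatorLp (hB.inter hC) f] with x h1 h2 h3
  rw [h1, h3]
  by_cases hxB : x ∈ B <;> by_cases hxC : x ∈ C <;> simp [hxB, hxC, h2]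

theorem inner_indicatorLp_left (hB : MeasurableSet B) (f g : Lp 𝕜 2 ρ) :
    inner 𝕜 (indicatorLp 𝕜 ρ hB f) g = inner 𝕜 f (indicatorLp 𝕜 ρ hB g) := by
  rw [L2.inner_def, L2.inner_def]
  refine integral_congr_ae ?_
  filter_upwards [coeFn_indicatorLp hB f, coeFn_indicatorLp hB g] with x h1 h2
  rw [h1, h2]
  by_cases h : x ∈ B <;> simp [h]

theorem isStarProjection_indicatorLp (hB : MeasurableSet B) :
    IsStarProjection (indicatorLp 𝕜 ρ hB) where
  isIdempotentElem := by
    ext1 f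
    rw [mul_apply_eq_comp, indicatorLp_apply_apply]
    simp only [Set.inter_self]
  isSelfAdjoint := ContinuousLinearMap.isSelfAdjoint_iff_isSymmetric.2
    (inner_indicatorLp_left hB)

theorem indicatorLp_univ : indicatorLp 𝕜 ρ MeasurableSet.univ = 1 := by
  ext1 f
  refine Lp.ext ((coeFn_indicatorLp _ f).trans ?_)
  simp

theorem inner_indicatorLp_self (hB : MeasurableSet B) (f : Lp 𝕜 2 ρ) :
    inner 𝕜 f (indicatorLp 𝕜 ρ hB f) = ((∫ x in B, ‖f x‖ ^ 2 ∂ρ : ℝ) : 𝕜) := by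
  rw [L2.inner_def, ← integral_ofReal, ← integral_indicator hB]
  refine integral_congr_ae ?_
  filter_upwards [coeFn_indicatorLp hB f] with x hx
  rw [hx]
  by_cases h : x ∈ B <;> simp [h]

theorem norm_indicatorLp_sq (hB : MeasurableSet B) (f : Lp 𝕜 2 ρ) :
    ‖indicatorLp 𝕜 ρ hB f‖ ^ 2 = ∫ x in B, ‖f x‖ ^ 2 ∂ρ := by
  have h : ((‖indicatorLp 𝕜 ρ hB f‖ ^ 2 : ℝ) : 𝕜) = ((∫ x in B, ‖f x‖ ^ 2 ∂ρ : ℝ) : 𝕜) := by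
    rw [← inner_indicatorLp_self hB, RCLike.ofReal_pow, ← inner_self_eq_norm_sq_to_K,
      inner_indicatorLp_left, indicatorLp_apply_apply]
    simp only [Set.inter_self]
  exact_mod_cast h

theorem integrable_norm_sq (f : Lp 𝕜 2 ρ) : Integrable (fun x => ‖f x‖ ^ 2) ρ :=
  (memLp_two_iff_integrable_sq_norm (Lp.aestronglyMeasurable f)).1 (Lp.memLp f)

theorem hasSum_of_hasSum_norm_sq {ι E : Type*} [NormedAddCommGroup E] [InnerProductSpace 𝕜 E]
    {v : ι → E} {w : E} (hv : Pairwise fun i j => inner 𝕜 (v i) (v j) = 0)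
    (hw : ∀ i, inner 𝕜 w (v i) = (‖v i‖ : 𝕜) ^ 2)
    (h : HasSum (fun i => ‖v i‖ ^ 2) (‖w‖ ^ 2)) : HasSum v w := by
  have hwsum (s : Finset ι) : inner 𝕜 w (∑ i ∈ s, v i) = ((∑ i ∈ s, ‖v i‖ ^ 2 : ℝ) : 𝕜) := by
    simp [inner_sum, hw]
  have hsum (s : Finset ι) : inner 𝕜 (∑ i ∈ s, v i) (∑ i ∈ s, v i) =
      ((∑ i ∈ s, ‖v i‖ ^ 2 : ℝ) : 𝕜) := by
    simp_rw [sum_inner, inner_sum, RCLike.ofReal_sum]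
    refine Finset.sum_congr rfl fun i hi => ?_
    rw [Finset.sum_eq_single_of_mem i hi fun j _ hj => hv hj.symm, inner_self_eq_norm_sq_to_K,
      RCLike.ofReal_pow]
  have hsub (s : Finset ι) : ‖∑ i ∈ s, v i - w‖ ^ 2 = ‖w‖ ^ 2 - ∑ i ∈ s, ‖v i‖ ^ 2 := by
    rw [norm_sub_rev, norm_sub_sq (𝕜 := 𝕜), hwsum, RCLike.ofReal_re,
      ← inner_self_eq_norm_sq (𝕜 := 𝕜) (∑ i ∈ s, v i), hsum, RCLike.ofReal_re]
    ring
  rw [HasSum, tendsto_iff_norm_sub_tendsto_zero]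
  have hlim := (Filter.Tendsto.const_sub (‖w‖ ^ 2) h).sqrt
  simpa only [← hsub, Real.sqrt_sq (norm_nonneg _), sub_self, Real.sqrt_zero] using hlim

theorem hasSum_indicatorLp_iUnion {ι : Type*} [Countable ι] {B : ι → Set α}
    (hB : ∀ i, MeasurableSet (B i)) (hd : Pairwise (Function.onFun Disjoint B))
    (f : Lp 𝕜 2 ρ) :
    HasSum (fun i => indicatorLp 𝕜 ρ (hB i) f) (indicatorLp 𝕜 ρ (MeasurableSet.iUnion hB) f) := by
  refine hasSum_of_hasSum_norm_sq (𝕜 := 𝕜) (fun i j hij => ?_) (fun i => ?_) ?_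
  · beta_reduce
    rw [inner_indicatorLp_left, indicatorLp_apply_apply, inner_indicatorLp_self,
      (hd hij).inter_eq]
    simp
  · rw [inner_indicatorLp_left, indicatorLp_apply_apply, inner_indicatorLp_self,
      ← RCLike.ofReal_pow, norm_indicatorLp_sq,
      Set.inter_eq_self_of_subset_right (Set.subset_iUnion B i)]
  · simp only [norm_indicatorLp_sq]
    exact hasSum_integral_iUnion hB hd (integrable_norm_sq f).integrableOn

end Multiplication

section WithDensity

variable {α F : Type*} [MeasurableSpace α] {ρ : Measure α} [NormedAddCommGroup F]
  [NormedSpace ℝ F] {p : α → ℝ}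

theorem integrable_withDensity_ofReal_iff (hp : AEMeasurable p ρ) (hp0 : 0 ≤ p) {g : α → F} :
    Integrable g (ρ.withDensity fun x => ENNReal.ofReal (p x)) ↔
      Integrable (fun x => p x • g x) ρ := by
  rw [integrable_withDensity_iff_integrable_smul₀' hp.ennreal_ofReal
    (ae_of_all _ fun _ => ENNReal.ofReal_lt_top)]
  simp only [ENNReal.toReal_ofReal (hp0 _)]

theorem integral_withDensity_ofReal (hp : AEMeasurable p ρ) (hp0 : 0 ≤ p) (g : α → F) :
    ∫ x, g x ∂ρ.withDensity (fun x => ENNReal.ofReal (p x)) = ∫ x, p x • g x ∂ρ := by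
  rw [integral_withDensity_eq_integral_toReal_smul₀ hp.ennreal_ofReal
    (ae_of_all _ fun _ => ENNReal.ofReal_lt_top)]
  simp only [ENNReal.toReal_ofReal (hp0 _)]

end WithDensity

section SpectralResolution

variable {H : Type*} [NormedAddCommGroup H] [InnerProductSpace ℂ H] [CompleteSpace H]
  {ρ : Measure ℝ}

open Classical in
/-- The projection-valued measure `B ↦ U⁻¹ 1_B U` obtained by pulling back multiplication by
indicator functions from `L²(ρ)`. -/
def spectralResolution (U : H ≃ₗᵢ[ℂ] Lp ℂ 2 ρ) : ProjectionValuedMeasure H where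
  proj B := if hB : MeasurableSet B then U.symm.conjStarAlgEquiv (indicatorLp ℂ ρ hB) else 0
  isStarProjection B hB := by
    simpa only [hB, dif_pos] using (isStarProjection_indicatorLp hB).map U.symm.conjStarAlgEquiv
  proj_univ := by
    simp only [MeasurableSet.univ, dif_pos, indicatorLp_univ, map_one]
  hasSum_proj B hB hd u := by
    simp only [hB, MeasurableSet.iUnion hB, dif_pos]
    exact (hasSum_indicatorLp_iUnion hB hd (U u)).mapL
      (U.symm.toContinuousLinearEquiv : Lp ℂ 2 ρ →L[ℂ] H)
  proj_of_not_measurable B hB := by simp only [hB, dif_neg, not_false_eq_true]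

theorem inner_spectralResolution_proj (U : H ≃ₗᵢ[ℂ] Lp ℂ 2 ρ) {B : Set ℝ} (hB : MeasurableSet B)
    (u : H) :
    inner ℂ u ((spectralResolution U).proj B u) = ((∫ x in B, ‖U u x‖ ^ 2 ∂ρ : ℝ) : ℂ) := by
  simp only [spectralResolution, hB, dif_pos]
  rw [LinearIsometryEquiv.conjStarAlgEquiv_apply_apply, LinearIsometryEquiv.symm_symm,
    ← U.inner_map_map, U.apply_symm_apply]
  exact inner_indicatorLp_self hB (U u)

theorem scalarMeasure_spectralResolution (U : H ≃ₗᵢ[ℂ] Lp ℂ 2 ρ) (u : H) :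
    (spectralResolution U).scalarMeasure u =
      ρ.withDensity fun x => ENNReal.ofReal (‖U u x‖ ^ 2) := by
  ext B hB
  rw [ProjectionValuedMeasure.scalarMeasure, Measure.ofMeasurable_apply _ hB,
    withDensity_apply _ hB, inner_spectralResolution_proj U hB, Complex.ofReal_re,
    ofReal_integral_eq_lintegral_ofReal (integrable_norm_sq (U u)).integrableOn
      (ae_of_all _ fun x => by positivity)]

theorem scalarMeasure_spectralResolution_absolutelyContinuous (U : H ≃ₗᵢ[ℂ] Lp ℂ 2 ρ) (u : H) :
    (spectralResolution U).scalarMeasure u ≪ ρ := by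
  rw [scalarMeasure_spectralResolution]
  exact withDensity_absolutelyContinuous ρ _

theorem integrable_scalarMeasure_iff (U : H ≃ₗᵢ[ℂ] Lp ℂ 2 ρ) (u : H) {g : ℝ → ℝ} :
    Integrable g ((spectralResolution U).scalarMeasure u) ↔
      Integrable (fun x => ‖U u x‖ ^ 2 * g x) ρ := by
  rw [scalarMeasure_spectralResolution]
  exact integrable_withDensity_ofReal_iff (integrable_norm_sq (U u)).1.aemeasurable
    fun x => sq_nonneg _

theorem integral_scalarMeasure (U : H ≃ₗᵢ[ℂ] Lp ℂ 2 ρ) (u : H) (g : ℝ → ℝ) :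
    ∫ x, g x ∂(spectralResolution U).scalarMeasure u = ∫ x, ‖U u x‖ ^ 2 * g x ∂ρ := by
  rw [scalarMeasure_spectralResolution]
  exact integral_withDensity_ofReal (integrable_norm_sq (U u)).1.aemeasurable
    (fun x => sq_nonneg _) g

end SpectralResolution

theorem isClosed_ofReal_image_support (ρ : Measure ℝ) : IsClosed (Complex.ofReal '' ρ.support) :=
  Complex.isometry_ofReal.isClosedEmbedding.isClosedMap _ Measure.isClosed_support

section SupportSub

open scoped ENNReal

variable {ρ : Measure ℝ} {z : ℂ}

theorem ae_ofReal_sub_ne_zero (hz : z ∉ Complex.ofReal '' ρ.support) :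
    ∀ᵐ x : ℝ ∂ρ, (x : ℂ) - z ≠ 0 := by
  filter_upwards [Measure.support_mem_ae] with x hx h
  exact hz ⟨x, hx, sub_eq_zero.1 h⟩

theorem memLp_top_inv_sub (hz : z ∉ Complex.ofReal '' ρ.support) :
    MemLp (fun x : ℝ => ((x : ℂ) - z)⁻¹) ∞ ρ := by
  obtain ⟨ε, hε, hball⟩ :=
    Metric.isOpen_iff.1 (isClosed_ofReal_image_support ρ).isOpen_compl z hz
  have hm : Measurable fun x : ℝ => ((x : ℂ) - z)⁻¹ := by fun_prop
  refine memLp_top_of_bound hm.aestronglyMeasurable ε⁻¹ ?_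
  filter_upwards [Measure.support_mem_ae] with x hx
  rw [norm_inv]
  refine inv_anti₀ hε (not_lt.1 fun hlt => hball ?_ ⟨x, hx, rfl⟩)
  rwa [Metric.mem_ball, dist_eq_norm]

theorem exists_ae_norm_sub_mul_le [IsFiniteMeasure ρ] {t ε : ℝ} (ht : t ∈ ρ.support)
    (hε : 0 < ε) :
    ∃ f : Lp ℂ 2 ρ, f ≠ 0 ∧ ∀ᵐ x : ℝ ∂ρ, ‖((x : ℂ) - t) * f x‖ ≤ ε * ‖f x‖ := by
  let f : Lp ℂ 2 ρ :=
    indicatorConstLp 2 Metric.isOpen_ball.measurableSet (measure_ne_top ρ (Metric.ball t ε)) 1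
  have hf : f =ᵐ[ρ] (Metric.ball t ε).indicator fun _ => (1 : ℂ) := indicatorConstLp_coeFn
  refine ⟨f, fun h0 => ?_, ?_⟩
  · have hpos : 0 < ρ (Metric.ball t ε) :=
      (Measure.mem_support_iff_forall t).1 ht _ (Metric.ball_mem_nhds t hε)
    have hzero := Set.indicator_ae_eq_zero.1 (hf.symm.trans ((Lp.eq_zero_iff_ae_eq_zero).1 h0))
    rw [Function.support_const one_ne_zero, Set.inter_univ] at hzero
    exact hpos.ne' hzero
  · filter_upwards [hf] with x hx
    rw [hx, norm_mul]
    by_cases h : x ∈ Metric.ball t ε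
    · gcongr
      rw [← Complex.ofReal_sub, Complex.norm_real]
      exact (mem_ball_iff_norm.1 h).le
    · simp [h]

end SupportSub

namespace IsSpectralTransform

variable {H : Type*} [NormedAddCommGroup H] [InnerProductSpace ℂ H]
  {A : H →ₗ.[ℂ] H} {φ : H} {ρ : Measure ℝ} {U : H ≃ₗᵢ[ℂ] Lp ℂ 2 ρ}

theorem mem_domain_iff (hU : IsSpectralTransform A φ ρ U) {u : H} :
    u ∈ A.domain ↔ MemLp (fun x : ℝ => (x : ℂ) * U u x) 2 ρ :=
  hU.2.1 u

theorem coeFn_map_apply (hU : IsSpectralTransform A φ ρ U) (u : A.domain) :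
    U (A u) =ᵐ[ρ] fun x : ℝ => (x : ℂ) * U (u : H) x :=
  hU.2.2 u

theorem isFiniteMeasure (hU : IsSpectralTransform A φ ρ U) : IsFiniteMeasure ρ := by
  have h : MemLp (fun _ => (1 : ℂ)) 2 ρ := (memLp_congr_ae hU.1).1 (Lp.memLp (U φ))
  exact ⟨((memLp_const_iff two_ne_zero ENNReal.ofNat_ne_top).1 h).resolve_left one_ne_zero⟩

theorem coeFn_map_sub_smul (hU : IsSpectralTransform A φ ρ U) (z : ℂ) (u : A.domain) :
    U (A u - z • (u : H)) =ᵐ[ρ] fun x : ℝ => ((x : ℂ) - z) * U (u : H) x := by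
  rw [map_sub, map_smul]
  filter_upwards [Lp.coeFn_sub (U (A u)) (z • U (u : H)), Lp.coeFn_smul z (U (u : H)),
    hU.coeFn_map_apply u] with x hsub hsmul hA
  rw [hsub, Pi.sub_apply, hsmul, Pi.smul_apply, hA, smul_eq_mul, sub_mul]

theorem isFormalAdjoint (hU : IsSpectralTransform A φ ρ U) : A.IsFormalAdjoint A := by
  intro u v
  rw [← U.inner_map_map, ← U.inner_map_map, L2.inner_def, L2.inner_def]
  refine integral_congr_ae ?_
  filter_upwards [hU.coeFn_map_apply u, hU.coeFn_map_apply v] with x hu hv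
  rw [hu, hv, RCLike.inner_apply, RCLike.inner_apply, map_mul, Complex.conj_ofReal]
  ring

theorem inner_apply_self (hU : IsSpectralTransform A φ ρ U) (u : A.domain) :
    inner ℂ (u : H) (A u) = ((∫ x, ‖U (u : H) x‖ ^ 2 * x ∂ρ : ℝ) : ℂ) := by
  rw [← U.inner_map_map, L2.inner_def, ← integral_complex_ofReal]
  refine integral_congr_ae ?_
  filter_upwards [hU.coeFn_map_apply u] with x hx
  rw [hx, RCLike.inner_apply, mul_assoc, Complex.mul_conj, Complex.normSq_eq_norm_sq,
    ← Complex.ofReal_mul, mul_comm]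

theorem integrable_norm_sq_mul (hU : IsSpectralTransform A φ ρ U) (u : A.domain) :
    Integrable (fun x => ‖U (u : H) x‖ ^ 2 * x) ρ := by
  refine ((hU.mem_domain_iff.1 u.2).integrable_mul (Lp.memLp (U (u : H))).star).re.congr
    (ae_of_all _ fun x => ?_)
  beta_reduce
  rw [Pi.mul_apply, Pi.star_apply, mul_assoc, RCLike.star_def, Complex.mul_conj,
    Complex.normSq_eq_norm_sq, ← Complex.ofReal_mul, RCLike.re_eq_complex_re, Complex.ofReal_re,
    mul_comm]

theorem isPositiveOperator (hU : IsSpectralTransform A φ ρ U) (hpos : ∀ᵐ x ∂ρ, 0 < x) :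
    IsPositiveOperator A := by
  intro u hu
  rw [hU.inner_apply_self, Complex.ofReal_im, Complex.ofReal_re]
  refine ⟨rfl, ?_⟩
  have h0 : 0 ≤ᵐ[ρ] fun x => ‖U (u : H) x‖ ^ 2 * x := by
    filter_upwards [hpos] with x hx
    exact mul_nonneg (sq_nonneg _) hx.le
  refine (integral_nonneg_of_ae h0).lt_of_ne fun h => hu (Subtype.ext (U.map_eq_zero_iff.1 ?_))
  rw [Lp.eq_zero_iff_ae_eq_zero]
  filter_upwards [(integral_eq_zero_iff_of_nonneg_ae h0 (hU.integrable_norm_sq_mul u)).1 h.symm,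
    hpos] with x hx hx0
  simpa [hx0.ne'] using hx

theorem exists_norm_sub_smul_le (hU : IsSpectralTransform A φ ρ U) {t ε : ℝ}
    (ht : t ∈ ρ.support) (hε : 0 < ε) :
    ∃ u : A.domain, u ≠ 0 ∧ ‖A u - (t : ℂ) • (u : H)‖ ≤ ε * ‖(u : H)‖ := by
  have := hU.isFiniteMeasure
  obtain ⟨f, hf0, hf⟩ := exists_ae_norm_sub_mul_le ht hε
  have hdom : U.symm f ∈ A.domain := by
    rw [hU.mem_domain_iff, U.apply_symm_apply]
    have := Lp.aestronglyMeasurable f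
    have := ((Lp.memLp f).of_le_mul (by fun_prop) hf).add ((Lp.memLp f).const_mul (t : ℂ))
    refine this.ae_eq (ae_of_all _ fun x => ?_)
    simp only [Pi.add_apply]
    ring
  refine ⟨⟨U.symm f, hdom⟩, by simpa using hf0, ?_⟩
  rw [← U.norm_map, U.symm.norm_map]
  refine Lp.norm_le_mul_norm_of_ae_le_mul ?_
  filter_upwards [hU.coeFn_map_sub_smul t ⟨U.symm f, hdom⟩, hf] with x hx hle
  rwa [hx, U.apply_symm_apply]

variable [CompleteSpace H]

theorem isResolventAt (hU : IsSpectralTransform A φ ρ U) {z : ℂ}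
    (hz : z ∉ Complex.ofReal '' ρ.support) :
    IsResolventAt A z (U.symm.conjStarAlgEquiv (mulLp ((memLp_top_inv_sub hz).toLp _))) := by
  set M : Lp ℂ 2 ρ →L[ℂ] Lp ℂ 2 ρ := mulLp ((memLp_top_inv_sub hz).toLp _)
  have hM (f : Lp ℂ 2 ρ) : ∀ᵐ x : ℝ ∂ρ, M f x = ((x : ℂ) - z)⁻¹ * f x := by
    filter_upwards [coeFn_mulLp _ f, (memLp_top_inv_sub hz).coeFn_toLp] with x hx h
    rw [hx, h]
  have hne := ae_ofReal_sub_ne_zero hz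
  simp only [IsResolventAt, LinearIsometryEquiv.conjStarAlgEquiv_apply_apply,
    LinearIsometryEquiv.symm_symm]
  refine ⟨fun v => ?_, fun u => ?_⟩
  · have hdom : U.symm (M (U v)) ∈ A.domain := by
      rw [hU.mem_domain_iff, U.apply_symm_apply]
      refine ((Lp.memLp (U v)).add ((Lp.memLp (M (U v))).const_mul z)).ae_eq ?_
      filter_upwards [hM (U v), hne] with x hx h
      rw [Pi.add_apply, hx]
      field_simp
      ring
    refine ⟨hdom, U.injective (Lp.ext ?_)⟩
    filter_upwards [hU.coeFn_map_sub_smul z ⟨_, hdom⟩, hM (U v), hne] with x hA hx h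
    rw [hA, U.apply_symm_apply, hx, mul_inv_cancel_left₀ h]
  · rw [U.symm_apply_eq]
    refine Lp.ext ?_
    filter_upwards [hU.coeFn_map_sub_smul z u, hM (U (A u - z • (u : H))), hne] with x hA hx h
    rw [hx, hA, inv_mul_cancel_left₀ h]

theorem inner_resolvent (hU : IsSpectralTransform A φ ρ U) {z : ℂ}
    (hz : z ∉ Complex.ofReal '' ρ.support) :
    inner ℂ φ (resolvent A z φ) = ∫ x : ℝ, ((x : ℂ) - z)⁻¹ ∂ρ := by
  rw [(hU.isResolventAt hz).resolvent_eq, LinearIsometryEquiv.conjStarAlgEquiv_apply_apply,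
    LinearIsometryEquiv.symm_symm, ← U.inner_map_map, U.apply_symm_apply, L2.inner_def]
  refine integral_congr_ae ?_
  filter_upwards [hU.1, coeFn_mulLp ((memLp_top_inv_sub hz).toLp _) (U φ),
    (memLp_top_inv_sub hz).coeFn_toLp] with x h1 h2 h3
  rw [h2, h1, h3, RCLike.inner_apply, map_one, mul_one, mul_one]

theorem isSelfAdjoint (hU : IsSpectralTransform A φ ρ U) : IsSelfAdjoint A := by
  have hz {z : ℂ} (h : z.im ≠ 0) : z ∉ Complex.ofReal '' ρ.support := by
    rintro ⟨x, -, rfl⟩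
    exact h (Complex.ofReal_im x)
  exact isSelfAdjoint_of_surjective_sub (z := Complex.I) hU.isFormalAdjoint (by simp)
    (hU.isResolventAt (hz (by simp))).surjective_sub
    (hU.isResolventAt (hz (by simp))).surjective_sub

theorem spectrum_eq (hU : IsSpectralTransform A φ ρ U) :
    spectrum A = Complex.ofReal '' ρ.support := by
  refine Set.Subset.antisymm (fun z hz => ?_) ?_
  · contrapose! hz
    exact not_not.2 ⟨_, hU.isResolventAt hz⟩
  · rintro _ ⟨t, ht, rfl⟩
    exact mem_spectrum_of_forall_exists_norm_sub_le fun ε hε => hU.exists_norm_sub_smul_le ht hε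

theorem isResolutionOf (hU : IsSpectralTransform A φ ρ U) :
    (spectralResolution U).IsResolutionOf A := by
  refine ⟨fun u => ?_, fun u => ?_⟩
  · have := Lp.aestronglyMeasurable (U u)
    rw [hU.mem_domain_iff, integrable_scalarMeasure_iff,
      memLp_two_iff_integrable_sq_norm (by fun_prop)]
    simp only [norm_mul, mul_pow, Complex.norm_real, Real.norm_eq_abs, sq_abs, mul_comm]
  · rw [hU.inner_apply_self, integral_scalarMeasure]

theorem scalarMeasure_cyclic (hU : IsSpectralTransform A φ ρ U) :
    (spectralResolution U).scalarMeasure φ = ρ := by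
  rw [scalarMeasure_spectralResolution]
  conv_rhs => rw [← withDensity_one (μ := ρ)]
  refine withDensity_congr_ae ?_
  filter_upwards [hU.1] with x hx
  simp [hx]

end IsSpectralTransform

/-! ### Measures determined by their moments -/

section Moments

open ProbabilityTheory Filter Topology Real

theorem measure_ext_of_integral_pow_eq {μ ν : Measure ℝ} [IsFiniteMeasure μ] [IsFiniteMeasure ν]
    (hμ : 0 ∈ interior (integrableExpSet id μ)) (hν : 0 ∈ interior (integrableExpSet id ν))
    (h : ∀ n : ℕ, ∫ x, x ^ n ∂μ = ∫ x, x ^ n ∂ν) : μ = ν := by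
  let S : Set ℝ := interior (integrableExpSet id μ) ∩ interior (integrableExpSet id ν)
  have hS : IsPreconnected {z : ℂ | z.re ∈ S} :=
    ((convex_integrableExpSet.interior.inter convex_integrableExpSet.interior).linear_preimage
      Complex.reLm).isPreconnected
  have hAμ : AnalyticOnNhd ℂ (complexMGF id μ) {z : ℂ | z.re ∈ S} :=
    analyticOnNhd_complexMGF.mono fun _ hz => hz.1
  have hAν : AnalyticOnNhd ℂ (complexMGF id ν) {z : ℂ | z.re ∈ S} :=
    analyticOnNhd_complexMGF.mono fun _ hz => hz.2
  have hderiv {κ : Measure ℝ} (hκ : 0 ∈ interior (integrableExpSet id κ)) (n : ℕ) :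
      iteratedDeriv n (complexMGF id κ) 0 = ((∫ x, x ^ n ∂κ : ℝ) : ℂ) := by
    rw [iteratedDeriv_complexMGF hκ n, ← integral_complex_ofReal]
    simp
  have hnhds : complexMGF id μ =ᶠ[𝓝 0] complexMGF id ν := by
    have h1 := (hAμ 0 ⟨hμ, hν⟩).hasFPowerSeriesAt
    have h2 := (hAν 0 ⟨hμ, hν⟩).hasFPowerSeriesAt
    simp only [hderiv hμ, hderiv hν, h] at h1 h2
    filter_upwards [h1.eventually_hasSum_sub, h2.eventually_hasSum_sub] with z hz1 hz2
    exact hz1.unique hz2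
  have hEq := hAμ.eqOn_of_preconnected_of_eventuallyEq hAν hS ⟨hμ, hν⟩ hnhds
  refine Measure.ext_of_charFun (funext fun t => ?_)
  rw [← complexMGF_id_mul_I, ← complexMGF_id_mul_I]
  exact hEq (by simpa [S] using ⟨hμ, hν⟩)

variable {ρ : Measure ℝ} {a : ℝ}

theorem norm_pow_mul_exp_neg_mul_abs_le (ha : 0 < a) (n : ℕ) (x : ℝ) :
    ‖x ^ n * exp (-(a * |x|))‖ ≤ n.factorial / a ^ n := by
  have h := pow_div_factorial_le_exp (a * |x|) (by positivity) n
  rw [div_le_iff₀ (by positivity), mul_pow] at h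
  rw [norm_mul, norm_pow, Real.norm_eq_abs, Real.norm_eq_abs, abs_exp, exp_neg,
    ← div_eq_mul_inv, div_le_div_iff₀ (exp_pos _) (by positivity)]
  linarith

theorem integrable_pow_smul {F : Type*} [NormedAddCommGroup F] [NormedSpace ℝ F]
    {g : ℝ → F} (ha : 0 < a) (hg : Integrable (fun x => exp (a * |x|) • g x) ρ) (n : ℕ) :
    Integrable (fun x => x ^ n • g x) ρ := by
  have hm : Measurable fun x : ℝ => x ^ n * exp (-(a * |x|)) := by fun_prop
  refine (hg.bdd_smul _ hm.aestronglyMeasurable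
    (ae_of_all _ (norm_pow_mul_exp_neg_mul_abs_le ha n))).congr (ae_of_all _ fun x => ?_)
  simp only [Pi.smul_apply', smul_smul, mul_assoc, ← exp_add, neg_add_cancel, exp_zero, mul_one]

theorem integrable_of_integrable_exp_smul {F : Type*} [NormedAddCommGroup F] [NormedSpace ℝ F]
    {g : ℝ → F} (ha : 0 < a) (hg : Integrable (fun x => exp (a * |x|) • g x) ρ) :
    Integrable g ρ := by
  simpa only [pow_zero, one_smul] using integrable_pow_smul ha hg 0

theorem zero_mem_interior_integrableExpSet_withDensity {p : ℝ → ℝ} (hp0 : 0 ≤ p) (ha : 0 < a)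
    (hp : Integrable (fun x => exp (a * |x|) • p x) ρ) :
    0 ∈ interior (integrableExpSet id (ρ.withDensity fun x => ENNReal.ofReal (p x))) := by
  have hpm := (integrable_of_integrable_exp_smul ha hp).1
  refine mem_interior.2 ⟨Set.Ioo (-a) a, fun t ht => ?_, isOpen_Ioo, by simp [ha]⟩
  refine (integrable_withDensity_ofReal_iff hpm.aemeasurable hp0).2 ?_
  refine hp.mono (by fun_prop) (ae_of_all _ fun x => ?_)
  rw [norm_smul, norm_smul, mul_comm, Real.norm_eq_abs (exp _), Real.norm_eq_abs (exp _), abs_exp,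
    abs_exp]
  refine mul_le_mul_of_nonneg_right (exp_le_exp.2 ?_) (norm_nonneg _)
  calc t * x ≤ |t| * |x| := (le_abs_self _).trans_eq (abs_mul _ _)
    _ ≤ a * |x| := by gcongr; exact (abs_lt.2 ht).le

theorem ae_eq_of_integral_pow_smul_eq {p q : ℝ → ℝ} (hp0 : 0 ≤ p) (hq0 : 0 ≤ q) (ha : 0 < a)
    (hp : Integrable (fun x => exp (a * |x|) • p x) ρ)
    (hq : Integrable (fun x => exp (a * |x|) • q x) ρ)
    (h : ∀ n : ℕ, ∫ x, x ^ n • p x ∂ρ = ∫ x, x ^ n • q x ∂ρ) : p =ᵐ[ρ] q := by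
  have hpi := integrable_of_integrable_exp_smul ha hp
  have hqi := integrable_of_integrable_exp_smul ha hq
  have := isFiniteMeasure_withDensity_ofReal hpi.2
  have := isFiniteMeasure_withDensity_ofReal hqi.2
  have heq : (ρ.withDensity fun x => ENNReal.ofReal (p x)) =
      ρ.withDensity fun x => ENNReal.ofReal (q x) := by
    refine measure_ext_of_integral_pow_eq
      (zero_mem_interior_integrableExpSet_withDensity hp0 ha hp)
      (zero_mem_interior_integrableExpSet_withDensity hq0 ha hq) fun n => ?_
    rw [integral_withDensity_ofReal hpi.1.aemeasurable hp0,
      integral_withDensity_ofReal hqi.1.aemeasurable hq0]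
    simpa only [smul_eq_mul, mul_comm] using h n
  filter_upwards [(withDensity_eq_iff hpi.1.aemeasurable.ennreal_ofReal
    hqi.1.aemeasurable.ennreal_ofReal hpi.lintegral_lt_top.ne).1 heq] with x hx
  exact (ENNReal.ofReal_eq_ofReal_iff (hp0 x) (hq0 x)).1 hx

theorem ae_eq_zero_of_integral_pow_smul_eq_zero_real {g : ℝ → ℝ} (ha : 0 < a)
    (hg : Integrable (fun x => exp (a * |x|) • g x) ρ)
    (h : ∀ n : ℕ, ∫ x, x ^ n • g x ∂ρ = 0) : g =ᵐ[ρ] 0 := by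
  have habs : Integrable (fun x => exp (a * |x|) • |g x|) ρ := by
    simpa only [norm_smul, Real.norm_eq_abs, abs_exp, smul_eq_mul, abs_mul] using hg.norm
  have hsum : (fun x => g x + |g x|) =ᵐ[ρ] fun x => |g x| := by
    refine ae_eq_of_integral_pow_smul_eq (fun x => ?_) (fun x => abs_nonneg _) ha
      ((hg.add habs).congr (ae_of_all _ fun x => (smul_add _ _ _).symm)) habs fun n => ?_
    · simpa only [Pi.zero_apply, neg_le_iff_add_nonneg] using neg_abs_le (g x)
    · simp only [smul_add]
      rw [integral_add (integrable_pow_smul ha hg n) (integrable_pow_smul ha habs n), h, zero_add]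
  filter_upwards [hsum] with x hx
  exact add_eq_right.1 hx

theorem ae_eq_zero_of_integral_pow_smul_eq_zero {𝕜 : Type*} [RCLike 𝕜] {g : ℝ → 𝕜} (ha : 0 < a)
    (hg : Integrable (fun x => exp (a * |x|) • g x) ρ)
    (h : ∀ n : ℕ, ∫ x, x ^ n • g x ∂ρ = 0) : g =ᵐ[ρ] 0 := by
  have hre : (fun x => RCLike.re (g x)) =ᵐ[ρ] 0 := by
    refine ae_eq_zero_of_integral_pow_smul_eq_zero_real ha
      (by simpa only [RCLike.smul_re, smul_eq_mul] using hg.re) fun n => ?_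
    simpa only [RCLike.smul_re, smul_eq_mul, h, map_zero] using
      integral_re (integrable_pow_smul ha hg n)
  have him : (fun x => RCLike.im (g x)) =ᵐ[ρ] 0 := by
    refine ae_eq_zero_of_integral_pow_smul_eq_zero_real ha
      (by simpa only [RCLike.smul_im, smul_eq_mul] using hg.im) fun n => ?_
    simpa only [RCLike.smul_im, smul_eq_mul, h, map_zero] using
      integral_im (integrable_pow_smul ha hg n)
  filter_upwards [hre, him] with x h1 h2
  exact RCLike.ext (h1.trans (map_zero _).symm) (h2.trans (map_zero _).symm)

end Moments

/-! ### Laguerre polynomials -/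

section LaguerrePolynomial

open Polynomial Finset Nat

/-- The Laguerre polynomial of degree `n` with the sign normalization `(-1)ⁿ Lₙ`, whose three-term
recurrence has the positive coefficients of `tau`. -/
def laguerre (n : ℕ) : ℝ[X] :=
  ∑ k ∈ range (n + 1), C ((-1 : ℝ) ^ (n + k) * n.choose k / k !) * X ^ k

theorem coeff_laguerre (n k : ℕ) :
    (laguerre n).coeff k = (-1) ^ (n + k) * n.choose k / k ! := by
  simp only [laguerre, finsetSum_coeff, coeff_C_mul_X_pow, sum_ite_eq, mem_range]
  split_ifs with h
  · rfl
  · rw [choose_eq_zero_of_lt (by omega)]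
    simp

theorem eval_laguerre (n : ℕ) (x : ℝ) :
    (laguerre n).eval x = ∑ k ∈ range (n + 1), (-1) ^ (n + k) * n.choose k / k ! * x ^ k := by
  simp [laguerre, eval_finsetSum]

theorem natDegree_laguerre_le (n : ℕ) : (laguerre n).natDegree ≤ n := by
  refine natDegree_le_iff_coeff_eq_zero.2 fun k hk => ?_
  simp [coeff_laguerre, choose_eq_zero_of_lt hk]

theorem coeff_laguerre_self (n : ℕ) : (laguerre n).coeff n = (n ! : ℝ)⁻¹ := by
  simp [coeff_laguerre]

theorem laguerre_zero : laguerre 0 = 1 := by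
  simp [laguerre]

theorem laguerre_one : laguerre 1 = X - 1 := by
  simp [laguerre, sum_range_succ, sub_eq_add_neg, add_comm]

theorem laguerre_mul_X (n : ℕ) :
    laguerre n * X = (n : ℝ) • laguerre (n - 1) + (2 * n + 1 : ℝ) • laguerre n +
      (n + 1 : ℝ) • laguerre (n + 1) := by
  rcases n with _ | n
  · simp [laguerre_zero, laguerre_one]
  ext k
  rcases k with _ | k
  · simp only [mul_coeff_zero, coeff_X_zero, mul_zero, coeff_add, coeff_smul, coeff_laguerre,
      add_zero, pow_succ, Nat.add_sub_cancel, choose_zero_right, factorial_zero, cast_add,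
      cast_one, smul_eq_mul]
    ring
  have h1 : ((n + 2).choose (k + 1) : ℝ) = (n + 1).choose k + (n + 1).choose (k + 1) := by
    exact_mod_cast Nat.choose_succ_succ (n + 1) k
  have h2 : ((n + 1).choose (k + 1) : ℝ) = n.choose k + n.choose (k + 1) := by
    exact_mod_cast Nat.choose_succ_succ n k
  have h3 : ((n : ℝ) + 2) * (n + 1).choose k = (n + 2).choose (k + 1) * (k + 1) := by
    exact_mod_cast Nat.add_one_mul_choose_eq (n + 1) k
  have h4 : ((n : ℝ) + 1) * n.choose k = (n + 1).choose (k + 1) * (k + 1) := by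
    exact_mod_cast Nat.add_one_mul_choose_eq n k
  have hf : (k ! : ℝ) ≠ 0 := by positivity
  simp only [coeff_mul_X, coeff_add, coeff_smul, coeff_laguerre, factorial_succ, cast_mul,
    cast_add, cast_one, pow_add, pow_one, Nat.add_sub_cancel, smul_eq_mul]
  field_simp
  linear_combination (n + 2 : ℝ) * h1 - (n + 1 : ℝ) * h2 + h3 - h4 + ((k : ℝ) + 1) * h1

theorem span_range_laguerre : Submodule.span ℝ (Set.range laguerre) = ⊤ :=
  let S : Polynomial.Sequence ℝ :=
    ⟨laguerre, fun n => degree_eq_of_le_of_coeff_ne_zero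
      (natDegree_le_iff_degree_le.1 (natDegree_laguerre_le n))
      (by rw [coeff_laguerre_self]; positivity)⟩
  S.span fun n => (leadingCoeff_ne_zero.2 (S.ne_zero n)).isUnit

section MomentFunctional

variable {F : Type*} [NormedAddCommGroup F] [NormedSpace ℝ F] {ρ : Measure ℝ} {g : ℝ → F} {a : ℝ}

theorem integrable_eval_smul (hg : ∀ n : ℕ, Integrable (fun x => x ^ n • g x) ρ) (P : ℝ[X]) :
    Integrable (fun x => P.eval x • g x) ρ := by
  simp only [eval_eq_sum_range, sum_smul, mul_smul]
  exact integrable_finsetSum _ fun k _ => (hg k).fun_smul (P.coeff k)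

/-- The functional `P ↦ ∫ P g dρ` on polynomials, for a density `g` all of whose moments exist. -/
def momentFunctional (hg : ∀ n : ℕ, Integrable (fun x => x ^ n • g x) ρ) : ℝ[X] →ₗ[ℝ] F where
  toFun P := ∫ x, P.eval x • g x ∂ρ
  map_add' P Q := by
    simp only [eval_add, add_smul]
    exact integral_add (integrable_eval_smul hg P) (integrable_eval_smul hg Q)
  map_smul' c P := by
    simp only [eval_smul, smul_assoc, RingHom.id_apply]
    exact integral_smul c _

theorem momentFunctional_apply (hg : ∀ n : ℕ, Integrable (fun x => x ^ n • g x) ρ) (P : ℝ[X]) :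
    momentFunctional hg P = ∫ x, P.eval x • g x ∂ρ :=
  rfl

theorem ae_eq_zero_of_integral_laguerre_smul_eq_zero {𝕜 : Type*} [RCLike 𝕜] {g : ℝ → 𝕜}
    (ha : 0 < a) (hg : Integrable (fun x => Real.exp (a * |x|) • g x) ρ)
    (h : ∀ n : ℕ, ∫ x, (laguerre n).eval x • g x ∂ρ = 0) : g =ᵐ[ρ] 0 := by
  have hzero : momentFunctional (integrable_pow_smul ha hg) = 0 :=
    LinearMap.ext_on_range span_range_laguerre h
  refine ae_eq_zero_of_integral_pow_smul_eq_zero ha hg fun n => ?_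
  simpa [momentFunctional_apply] using LinearMap.congr_fun hzero (X ^ n)

theorem tau_integral_laguerre_smul {g : ℝ → ℂ}
    (hg : ∀ n : ℕ, Integrable (fun x => x ^ n • g x) ρ) (n : ℕ) :
    tau (fun n => ∫ x, (laguerre n).eval x • g x ∂ρ) n =
      ∫ x, (laguerre n).eval x • (x • g x) ∂ρ := by
  have hrec := congrArg (momentFunctional hg) (laguerre_mul_X n)
  simp only [map_add, map_smul, momentFunctional_apply, eval_mul, eval_X, mul_smul] at hrec
  rw [hrec]
  cases n <;> simp [tau]

end MomentFunctional

end LaguerrePolynomial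

/-! ### The Laguerre transform -/

section ExpMeasure

open ProbabilityTheory Real Set

theorem expMeasure_eq : expMeasure =
    (volume.restrict (Ioi 0)).withDensity fun x => ENNReal.ofReal (exp (-x)) := by
  rw [expMeasure, restrict_Ioi_eq_restrict_Ici, ← withDensity_indicator measurableSet_Ici]
  congr 1
  funext x
  by_cases h : x ∈ Ici (0 : ℝ) <;> simp [h]

theorem integrable_expMeasure_iff {F : Type*} [NormedAddCommGroup F] [NormedSpace ℝ F]
    {f : ℝ → F} : Integrable f expMeasure ↔ IntegrableOn (fun x => exp (-x) • f x) (Ioi 0) := by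
  rw [expMeasure_eq]
  exact integrable_withDensity_ofReal_iff (by fun_prop) fun x => (exp_pos _).le

theorem integral_expMeasure {F : Type*} [NormedAddCommGroup F] [NormedSpace ℝ F] (f : ℝ → F) :
    ∫ x, f x ∂expMeasure = ∫ x in Ioi 0, exp (-x) • f x := by
  rw [expMeasure_eq]
  exact integral_withDensity_ofReal (by fun_prop) (fun x => (exp_pos _).le) f

theorem mem_integrableExpSet_expMeasure {t : ℝ} (ht : t < 1) :
    t ∈ integrableExpSet id expMeasure := by
  refine integrable_expMeasure_iff.2
    ((exp_neg_integrableOn_Ioi 0 (sub_pos.2 ht)).congr_fun (fun x _ => ?_) measurableSet_Ioi)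
  simp only [id_eq, smul_eq_mul, ← exp_add]
  ring_nf

theorem mem_interior_integrableExpSet_expMeasure {t : ℝ} (ht : t < 1) :
    t ∈ interior (integrableExpSet id expMeasure) :=
  mem_interior.2 ⟨Iio 1, fun _ => mem_integrableExpSet_expMeasure, isOpen_Iio, ht⟩

instance : IsFiniteMeasure expMeasure := by
  simpa [integrableExpSet, integrable_const_iff] using
    mem_integrableExpSet_expMeasure zero_lt_one

theorem expMeasure_absolutelyContinuous : expMeasure ≪ volume :=
  withDensity_absolutelyContinuous _ _

theorem ae_expMeasure_pos : ∀ᵐ x ∂expMeasure, 0 < x := by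
  rw [expMeasure_eq]
  exact (withDensity_absolutelyContinuous _ _).ae_le (ae_restrict_mem measurableSet_Ioi)

theorem support_expMeasure : expMeasure.support = Ici 0 := by
  refine Subset.antisymm (Measure.support_subset_of_isClosed isClosed_Ici ?_) fun t ht => ?_
  · filter_upwards [ae_expMeasure_pos] with x hx using hx.le
  refine (Measure.mem_support_iff_forall t).2 fun V hV => pos_iff_ne_zero.2 fun h0 => ?_
  have hvol : volume.restrict (Ioi 0) V = 0 := by
    rw [expMeasure_eq] at h0
    exact withDensity_absolutelyContinuous' (by fun_prop)
      (ae_of_all _ fun x => by simp [exp_pos]) h0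
  have hne : (interior V ∩ Ioi 0).Nonempty :=
    mem_closure_iff_nhds.1 ((closure_Ioi (0 : ℝ)).symm ▸ ht) _ (interior_mem_nhds.2 hV)
  refine ((isOpen_interior.inter isOpen_Ioi).measure_pos volume hne).ne' ?_
  rw [← Measure.restrict_apply isOpen_interior.measurableSet]
  exact measure_mono_null interior_subset hvol

theorem integral_pow_expMeasure (n : ℕ) : ∫ x, x ^ n ∂expMeasure = n.factorial := by
  rw [integral_expMeasure, ← Gamma_nat_eq_factorial, Gamma_eq_integral (by positivity)]
  simp

theorem memLp_pow_mul_exp_mul_abs (n : ℕ) {t : ℝ} (ht : t < 1 / 2) :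
    MemLp (fun x => x ^ n * exp (t * |x|)) 2 expMeasure := by
  rw [memLp_two_iff_integrable_sq (by fun_prop)]
  refine (integrable_pow_mul_exp_of_mem_interior_integrableExpSet
    (mem_interior_integrableExpSet_expMeasure (t := 2 * t) (by linarith)) (n * 2)).congr ?_
  filter_upwards [ae_expMeasure_pos] with x hx
  rw [abs_of_pos hx, mul_pow, ← pow_mul, ← exp_nat_mul, id_eq]
  push_cast
  ring_nf

theorem integrable_exp_smul_pow_smul {F : Type*} [NormedAddCommGroup F] [NormedSpace ℝ F]
    {f : ℝ → F} (hf : MemLp f 2 expMeasure) (n : ℕ) {t : ℝ} (ht : t < 1 / 2) :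
    Integrable (fun x => exp (t * |x|) • (x ^ n • f x)) expMeasure := by
  refine ((hf.smul (memLp_pow_mul_exp_mul_abs n ht)).integrable le_rfl).congr
    (ae_of_all _ fun x => ?_)
  simp only [Pi.smul_apply', smul_smul, mul_comm]

end ExpMeasure

section LaguerreTransform

open Polynomial Finset Nat

theorem memLp_pow_expMeasure (n : ℕ) : MemLp (fun x => x ^ n) 2 expMeasure := by
  simpa using memLp_pow_mul_exp_mul_abs n (t := 0) (by norm_num)

theorem memLp_eval_expMeasure (P : ℝ[X]) : MemLp (fun x => P.eval x) 2 expMeasure := by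
  simp only [eval_eq_sum_range]
  exact memLp_finsetSum _ fun k _ => (memLp_pow_expMeasure k).const_mul _

theorem integrable_pow_expMeasure (n : ℕ) : Integrable (fun x => x ^ n) expMeasure :=
  (memLp_pow_expMeasure n).integrable one_le_two

theorem fwdDiff_iter_choose_of_le {m n : ℕ} (hmn : m ≤ n) (y : ℕ) :
    (fwdDiff 1)^[n] (fun x : ℕ => (x.choose m : ℤ)) y = if m = n then 1 else 0 := by
  obtain ⟨k, rfl⟩ := Nat.exists_eq_add_of_le' hmn
  have hm : (fwdDiff 1)^[m] (fun x : ℕ => (x.choose m : ℤ)) = fun _ => 1 := by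
    simpa using fwdDiff_iter_choose 0 m
  rw [Function.iterate_add_apply, hm]
  rcases k with _ | k
  · simp
  · rw [Function.iterate_succ_apply, fwdDiff_const, fwdDiff_iter_eq_sum_shift]
    simp

-- The sum is the `n`-th forward difference of `x ↦ x.choose m` at `m`.
theorem sum_neg_one_pow_mul_choose_mul_choose {m n : ℕ} (hmn : m ≤ n) :
    ∑ k ∈ range (n + 1), (-1 : ℤ) ^ (n + k) * n.choose k * (m + k).choose m =
      if m = n then 1 else 0 := by
  rw [← fwdDiff_iter_choose_of_le hmn m, fwdDiff_iter_eq_sum_shift]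
  refine sum_congr rfl fun k hk => ?_
  have hsign : (-1 : ℤ) ^ (n + k) = (-1) ^ (n - k) := by
    obtain ⟨j, rfl⟩ := Nat.exists_eq_add_of_le' (mem_range_succ_iff.1 hk)
    rw [Nat.add_sub_cancel, add_assoc, pow_add, (Even.add_self k).neg_one_pow, mul_one]
  simp [hsign]

theorem integral_pow_mul_laguerre {m n : ℕ} (hmn : m ≤ n) :
    ∫ x, x ^ m * (laguerre n).eval x ∂expMeasure = if m = n then (n ! : ℝ) else 0 := by
  have hterm (k : ℕ) : ∫ x, x ^ m * ((-1) ^ (n + k) * n.choose k / k ! * x ^ k) ∂expMeasure =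
      m ! * ((-1) ^ (n + k) * n.choose k * (m + k).choose m) := by
    have hfact : ((m + k).choose m * m ! * k ! : ℝ) = (m + k)! := by
      rw [choose_symm_add]
      exact_mod_cast Nat.add_choose_mul_factorial_mul_factorial m k
    simp only [mul_left_comm (_ ^ m), ← pow_add]
    rw [integral_const_mul, integral_pow_expMeasure, ← hfact]
    field_simp
  have hintegrable (k : ℕ) :
      Integrable (fun x : ℝ => x ^ m * ((-1) ^ (n + k) * n.choose k / k ! * x ^ k)) expMeasure := by
    simp only [mul_left_comm (_ ^ m), ← pow_add]
    exact (integrable_pow_expMeasure _).const_mul _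
  have hsum : ∑ k ∈ range (n + 1), (-1 : ℝ) ^ (n + k) * n.choose k * (m + k).choose m =
      if m = n then 1 else 0 := by
    exact_mod_cast sum_neg_one_pow_mul_choose_mul_choose hmn
  simp only [eval_laguerre, mul_sum]
  rw [integral_finsetSum _ fun k _ => hintegrable k]
  simp only [hterm]
  rw [← mul_sum, hsum]
  split_ifs with h <;> simp [h]

theorem integral_eval_mul_laguerre {P : ℝ[X]} {n : ℕ} (hP : P.natDegree ≤ n) :
    ∫ x, P.eval x * (laguerre n).eval x ∂expMeasure = P.coeff n * n ! := by
  have hintegrable (m : ℕ) :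
      Integrable (fun x => P.coeff m * (x ^ m * (laguerre n).eval x)) expMeasure :=
    ((memLp_pow_expMeasure m).integrable_mul (memLp_eval_expMeasure _)).const_mul _
  simp only [eval_eq_sum_range' (Nat.lt_succ_of_le hP) _, sum_mul, mul_assoc]
  rw [integral_finsetSum _ fun m _ => hintegrable m]
  simp only [integral_const_mul]
  rw [sum_congr rfl fun m hm => by rw [integral_pow_mul_laguerre (mem_range_succ_iff.1 hm)]]
  simp

theorem integral_laguerre_mul_laguerre (m n : ℕ) :
    ∫ x, (laguerre m).eval x * (laguerre n).eval x ∂expMeasure = if m = n then 1 else 0 := by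
  wlog hmn : m ≤ n generalizing m n
  · simpa only [mul_comm, eq_comm] using this n m (le_of_not_ge hmn)
  rw [integral_eval_mul_laguerre ((natDegree_laguerre_le m).trans hmn)]
  split_ifs with h
  · rw [h, coeff_laguerre_self, inv_mul_cancel₀ (by positivity)]
  · rw [coeff_laguerre, choose_eq_zero_of_lt (lt_of_le_of_ne hmn h)]
    simp

/-- The sign-normalized Laguerre polynomial as an element of `L²(expMeasure)`. -/
def laguerreLp (n : ℕ) : Lp ℂ 2 expMeasure := (memLp_eval_expMeasure (laguerre n)).ofReal.toLp _

theorem coeFn_laguerreLp (n : ℕ) :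
    laguerreLp n =ᵐ[expMeasure] fun x => (((laguerre n).eval x : ℝ) : ℂ) :=
  MemLp.coeFn_toLp _

theorem inner_laguerreLp (n : ℕ) (f : Lp ℂ 2 expMeasure) :
    inner ℂ (laguerreLp n) f = ∫ x, (laguerre n).eval x • f x ∂expMeasure := by
  rw [L2.inner_def]
  refine integral_congr_ae ?_
  filter_upwards [coeFn_laguerreLp n] with x hx
  rw [hx, RCLike.inner_apply, Complex.conj_ofReal, mul_comm, Complex.real_smul]

theorem orthonormal_laguerreLp : Orthonormal ℂ laguerreLp := by
  rw [orthonormal_iff_ite]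
  intro m n
  have hcongr : ∫ x, (laguerre m).eval x • laguerreLp n x ∂expMeasure =
      ∫ x, (((laguerre m).eval x * (laguerre n).eval x : ℝ) : ℂ) ∂expMeasure := by
    refine integral_congr_ae ?_
    filter_upwards [coeFn_laguerreLp n] with x hx
    rw [hx, Complex.real_smul, Complex.ofReal_mul]
  rw [inner_laguerreLp, hcongr, integral_complex_ofReal, integral_laguerre_mul_laguerre]
  split_ifs <;> simp

theorem integrable_exp_smul {f : ℝ → ℂ} (hf : MemLp f 2 expMeasure) :
    Integrable (fun x => Real.exp (1 / 4 * |x|) • f x) expMeasure := by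
  simpa using integrable_exp_smul_pow_smul hf 0 (t := 1 / 4) (by norm_num)

theorem integrable_exp_smul_smul {f : ℝ → ℂ} (hf : MemLp f 2 expMeasure) :
    Integrable (fun x => Real.exp (1 / 4 * |x|) • (x • f x)) expMeasure := by
  simpa using integrable_exp_smul_pow_smul hf 1 (t := 1 / 4) (by norm_num)

theorem span_laguerreLp_orthogonal : (Submodule.span ℂ (Set.range laguerreLp))ᗮ = ⊥ := by
  rw [Submodule.eq_bot_iff]
  intro f hf
  rw [Lp.eq_zero_iff_ae_eq_zero]
  refine ae_eq_zero_of_integral_laguerre_smul_eq_zero (by norm_num)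
    (integrable_exp_smul (Lp.memLp f)) fun n => ?_
  rw [← inner_laguerreLp]
  exact hf _ (Submodule.subset_span ⟨n, rfl⟩)

/-- The Laguerre polynomials as an orthonormal basis of `L²(expMeasure)`. -/
def laguerreBasis : HilbertBasis ℕ ℂ (Lp ℂ 2 expMeasure) :=
  HilbertBasis.mkOfOrthogonalEqBot orthonormal_laguerreLp span_laguerreLp_orthogonal

theorem laguerreBasis_apply (n : ℕ) : laguerreBasis n = laguerreLp n :=
  congrFun (HilbertBasis.coe_mkOfOrthogonalEqBot _ _) n

/-- The spectral transform of `H0`: the unitary map sending the unit vectors of `ℓ²` to the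
Laguerre polynomials. -/
def laguerreTransform : ℓ2 ≃ₗᵢ[ℂ] Lp ℂ 2 expMeasure := laguerreBasis.repr.symm

theorem laguerreTransform_symm_apply (f : Lp ℂ 2 expMeasure) (n : ℕ) :
    laguerreTransform.symm f n = ∫ x, (laguerre n).eval x • f x ∂expMeasure := by
  rw [laguerreTransform, LinearIsometryEquiv.symm_symm, HilbertBasis.repr_apply_apply,
    laguerreBasis_apply, inner_laguerreLp]

theorem apply_eq_integral_laguerre (u : ℓ2) (n : ℕ) :
    u n = ∫ x, (laguerre n).eval x • laguerreTransform u x ∂expMeasure := by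
  rw [← laguerreTransform_symm_apply, LinearIsometryEquiv.symm_apply_apply]

theorem laguerreTransform_delta0 : ∀ᵐ x ∂expMeasure, laguerreTransform delta0 x = 1 := by
  have h : laguerreTransform delta0 = laguerreLp 0 := by
    rw [laguerreTransform, delta0, HilbertBasis.repr_symm_single, laguerreBasis_apply]
  filter_upwards [coeFn_laguerreLp 0] with x hx
  rw [h, hx, laguerre_zero, eval_one, Complex.ofReal_one]

theorem tau_apply_eq_integral (u : ℓ2) (n : ℕ) :
    tau u n = ∫ x, (laguerre n).eval x • (x • laguerreTransform u x) ∂expMeasure := by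
  rw [← tau_integral_laguerre_smul (integrable_pow_smul (by norm_num)
    (integrable_exp_smul (Lp.memLp (laguerreTransform u))))]
  simp only [← apply_eq_integral_laguerre]

theorem laguerreTransform_ae_eq_of_tau_eq {u v : ℓ2} (h : tau u = v) :
    laguerreTransform v =ᵐ[expMeasure] fun x => x • laguerreTransform u x := by
  have hu := integrable_exp_smul_smul (Lp.memLp (laguerreTransform u))
  have hv := integrable_exp_smul (Lp.memLp (laguerreTransform v))
  have hzero : (fun x => laguerreTransform v x - x • laguerreTransform u x) =ᵐ[expMeasure] 0 := by
    refine ae_eq_zero_of_integral_laguerre_smul_eq_zero (by norm_num)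
      ((hv.sub hu).congr (ae_of_all _ fun x => (smul_sub _ _ _).symm)) fun n => ?_
    simp only [smul_sub]
    rw [integral_sub (integrable_eval_smul (integrable_pow_smul (by norm_num) hv) _)
        (integrable_eval_smul (integrable_pow_smul (by norm_num) hu) _),
      ← tau_apply_eq_integral, ← apply_eq_integral_laguerre, h, sub_self]
  filter_upwards [hzero] with x hx
  exact sub_eq_zero.1 hx

theorem tau_eq_laguerreTransform_symm {u : ℓ2}
    (h : MemLp (fun x : ℝ => (x : ℂ) * laguerreTransform u x) 2 expMeasure) :
    tau u = laguerreTransform.symm (h.toLp _) := by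
  funext n
  rw [laguerreTransform_symm_apply, tau_apply_eq_integral]
  refine integral_congr_ae ?_
  filter_upwards [h.coeFn_toLp] with x hx
  simp only [hx, Complex.real_smul]

theorem isSpectralTransform_laguerreTransform :
    IsSpectralTransform H0 delta0 expMeasure laguerreTransform := by
  have happly (u : H0.domain) : laguerreTransform (H0 u) =ᵐ[expMeasure]
      fun x : ℝ => (x : ℂ) * laguerreTransform (u : ℓ2) x :=
    laguerreTransform_ae_eq_of_tau_eq rfl
  refine ⟨laguerreTransform_delta0, fun u => ⟨fun hu => ?_, fun h => ?_⟩, happly⟩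
  · exact (Lp.memLp _).ae_eq (happly ⟨u, hu⟩)
  · change Memℓp (tau u) 2
    rw [tau_eq_laguerreTransform_symm h]
    exact lp.memℓp _

end LaguerreTransform

section WeylFunction

variable {z : ℂ}

theorem exp_smul_inv_sub (x : ℝ) (z : ℂ) :
    Real.exp (-x) • ((x : ℂ) - z)⁻¹ = Complex.exp (-(x : ℂ)) / ((x : ℂ) - z) := by
  rw [Complex.real_smul, Complex.ofReal_exp, Complex.ofReal_neg, div_eq_mul_inv]

theorem integrableOn_exp_div_sub (hz : z ∉ Complex.ofReal '' Set.Ici (0 : ℝ)) :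
    IntegrableOn (fun x : ℝ => Complex.exp (-(x : ℂ)) / ((x : ℂ) - z)) (Set.Ioi (0 : ℝ)) := by
  simp only [← exp_smul_inv_sub]
  rw [← support_expMeasure] at hz
  exact integrable_expMeasure_iff.1 ((memLp_top_inv_sub hz).integrable le_top)

theorem weylFunction_eq_integral (hz : z ∉ Complex.ofReal '' Set.Ici (0 : ℝ)) :
    weylFunction z = ∫ x in Set.Ioi (0 : ℝ), Complex.exp (-(x : ℂ)) / ((x : ℂ) - z) := by
  rw [← support_expMeasure] at hz
  rw [weylFunction, isSpectralTransform_laguerreTransform.inner_resolvent hz, integral_expMeasure]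
  simp only [exp_smul_inv_sub]

theorem exp_mul_expIntegralE1 (z : ℂ) :
    Complex.exp (-z) * expIntegralE1 (-z) =
      ∫ x in Set.Ioi (0 : ℝ), Complex.exp (-(x : ℂ)) / ((x : ℂ) - z) := by
  rw [expIntegralE1, ← integral_const_mul]
  congr 1
  funext x
  rw [← mul_div_assoc, ← Complex.exp_add]
  congr 2 <;> ring

end WeylFunction

end LaguerreJacobi

end

theorem theorem2p1 :
    -- (i) the operator is self-adjoint and positive
    (IsSelfAdjoint LaguerreJacobi.H0 ∧ LaguerreJacobi.IsPositiveOperator LaguerreJacobi.H0) ∧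
    -- (ii) the Weyl function
    (∀ z : ℂ, z ∉ Complex.ofReal '' Set.Ici (0 : ℝ) →
      LaguerreJacobi.weylFunction z = Complex.exp (-z) * LaguerreJacobi.expIntegralE1 (-z) ∧
      MeasureTheory.IntegrableOn (fun x : ℝ => Complex.exp (-(x : ℂ)) / ((x : ℂ) - z))
        (Set.Ioi (0 : ℝ)) ∧
      LaguerreJacobi.weylFunction z =
        ∫ x in Set.Ioi (0 : ℝ), Complex.exp (-(x : ℂ)) / ((x : ℂ) - z)) ∧
    -- (ii) unitary equivalence with multiplication in the weighted space
    (∃ U : LaguerreJacobi.ℓ2 ≃ₗᵢ[ℂ] MeasureTheory.Lp ℂ 2 LaguerreJacobi.expMeasure,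
      LaguerreJacobi.IsSpectralTransform LaguerreJacobi.H0 LaguerreJacobi.delta0
        LaguerreJacobi.expMeasure U) ∧
    -- (ii) the spectral measure, and (iii) pure absolute continuity
    (∃ E : LaguerreJacobi.ProjectionValuedMeasure LaguerreJacobi.ℓ2,
      E.IsResolutionOf LaguerreJacobi.H0 ∧
      E.scalarMeasure LaguerreJacobi.delta0 = LaguerreJacobi.expMeasure ∧
      ∀ u : LaguerreJacobi.ℓ2,
        (E.scalarMeasure u).AbsolutelyContinuous MeasureTheory.volume) ∧
    -- (iii) the spectrum
    LaguerreJacobi.spectrum LaguerreJacobi.H0 = Complex.ofReal '' Set.Ici (0 : ℝ) := by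
  open LaguerreJacobi in
  have hU := isSpectralTransform_laguerreTransform
  refine ⟨⟨hU.isSelfAdjoint, hU.isPositiveOperator ae_expMeasure_pos⟩, fun z hz => ⟨?_, ?_, ?_⟩,
    ⟨laguerreTransform, hU⟩,
    ⟨spectralResolution laguerreTransform, hU.isResolutionOf, hU.scalarMeasure_cyclic, fun u => ?_⟩,
    ?_⟩
  · rw [weylFunction_eq_integral hz, exp_mul_expIntegralE1]
  · exact integrableOn_exp_div_sub hz
  · exact weylFunction_eq_integral hz
  · exact (scalarMeasure_spectralResolution_absolutelyContinuous _ u).trans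
      expMeasure_absolutelyContinuous
  · rw [hU.spectrum_eq, support_expMeasure]
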